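/- A hypergraph on a finite set $V$ is a nonempty set of subsets of $V$ (edges), each of cardinality at least $2$. A hypertree on $V$ is a hypergraph on $V$ that is connected and has no cycle, where a cycle is an alternating cyclic sequence $v_0,e_0,v_1,e_1,\dots,v_m,e_m,v_0$ with $m\ge 1$, distinct vertices $v_i$ and distinct edges $e_i$, each edge containing its two neighbours in the sequence. Its rank $\operatorname{Rg}(T)$ is its number of edges minus one. A cyclic hypertree is a hypertree together with, at every vertex, a cyclic order on the set of edges containing this vertex; it is flag-pointed if moreover a vertex and an edge containing this vertex are distinguished. Let $$\mathsf{HAC}(x)=\sum_{n\ge 2}\ \sum_{T} t^{\operatorname{Rg}(T)}\,\frac{x^n}{n!},\qquad \mathsf{HAC}^{pa}(x)=\sum_{n\ge 2}\ \sum_{T'} t^{\operatorname{Rg}(T')}\,\frac{x^n}{n!},$$ where $T$ runs over the cyclic hypertrees on $\{1,\dots,n\}$ and $T'$ over the flag-pointed cyclic hypertrees on $\{1,\dots,n\}$. Let $K$ be a field of characteristic $0$ and let $t\in K$, $t\neq 0$ (for instance $K=\mathbb{Q}(t)$ with $t$ an indeterminate). Among the pairs $(A,z)$ of formal power series in the indeterminate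 $B$ with coefficients in $K$, $z$ having zero constant term, the system $$A=-\frac1t\ln\!\left(\frac Bz\right),\qquad B=z-t\,z\,(\exp(z)-1)$$ (where $B/z$ is required to be a formal power series with constant term $1$) has exactly one solution, namely $$A=\partial_B\,\mathsf{HAC}(B),\qquad z=B+t\,\mathsf{HAC}^{pa}(B).$$ -/

import Mathlib

open scoped PowerSeries

namespace HypertreeSeries

/-- A hypergraph on the vertex set `V`: a nonempty set of subsets of `V` (the edges), each of
cardinality at least `2`. -/
def IsHypergraph {V : Type*} (E : Finset (Finset V)) : Prop :=
  E.Nonempty ∧ ∀ e ∈ E, 2 ≤ e.card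

/-- Two vertices are joined by a path, i.e. an alternating sequence of vertices and edges in which
every edge contains the two vertices adjacent to it. -/
def Joined {V : Type*} (E : Finset (Finset V)) : V → V → Prop :=
  Relation.ReflTransGen fun v w => ∃ e ∈ E, v ∈ e ∧ w ∈ e

/-- A (Berge) cycle `v₀, e₀, v₁, e₁, …, vₘ, eₘ, v₀` with `m + 1 ≥ 2` distinct vertices and as many
distinct edges, each edge containing the two vertices adjacent to it.
Indices are taken modulo `m + 1`. -/
def HasCycle {V : Type*} (E : Finset (Finset V)) : Prop :=
  ∃ (k : ℕ) (v : Fin (k + 2) → V) (e : Fin (k + 2) → Finset V),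
    Function.Injective v ∧ Function.Injective e ∧
      ∀ i, e i ∈ E ∧ v i ∈ e i ∧ v (i + 1) ∈ e i

/-- A hypertree on `V`: a connected hypergraph on `V` without cycles. -/
structure Hypertree (V : Type*) where
  edges : Finset (Finset V)
  isHypergraph : IsHypergraph edges
  connected : ∀ v w : V, Joined edges v w
  acyclic : ¬ HasCycle edges

/-- The edges of a hypertree that contain a given vertex. -/
abbrev Hypertree.EdgesAt {V : Type*} (T : Hypertree V) (v : V) : Type _ :=
  {e : Finset V // e ∈ T.edges ∧ v ∈ e}

/-- The rank of a hypertree is its number of edges minus one (there is at least one edge). -/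
def Hypertree.rank {V : Type*} (T : Hypertree V) : ℕ := T.edges.card - 1

/-- A cyclic order on a (finite) set, given by its successor map: a permutation with at most one
orbit, the elements following each other along the orbit. -/
abbrev CyclicOrder (α : Type*) : Type _ :=
  {σ : Equiv.Perm α // σ.IsCycleOn Set.univ}

/-- A cyclic hypertree: a hypertree with, at every vertex, a cyclic order on the set of edges
containing this vertex. -/
abbrev CyclicHypertree (V : Type*) : Type _ :=
  (T : Hypertree V) × ((v : V) → CyclicOrder (T.EdgesAt v))

/-- A flag-pointed cyclic hypertree: a cyclic hypertree with a flag, i.e. a distinguished vertex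
and a distinguished edge containing it. -/
abbrev FlagPointedCyclicHypertree (V : Type*) : Type _ :=
  (H : CyclicHypertree V) × ((v : V) × H.1.EdgesAt v)

instance {V : Type*} [Finite V] : Finite (Hypertree V) :=
  Finite.of_injective Hypertree.edges fun S T h => by
    cases S; cases T; simp_all

noncomputable instance {V : Type*} [Finite V] : Fintype (CyclicHypertree V) :=
  Fintype.ofFinite _

noncomputable instance {V : Type*} [Finite V] : Fintype (FlagPointedCyclicHypertree V) :=
  Fintype.ofFinite _

/-- The exponential generating series of cyclic hypertrees, each counted with weight
`t ^ rank`. (There is no hypertree on fewer than two vertices, so that the sum starts at `2`.) -/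
noncomputable def HAC {K : Type*} [Field K] (t : K) : K⟦X⟧ :=
  PowerSeries.mk fun n => (∑ H : CyclicHypertree (Fin n), t ^ H.1.rank) / (n.factorial : K)

/-- The exponential generating series of flag-pointed cyclic hypertrees, each counted with weight
`t ^ rank`. -/
noncomputable def HACpa {K : Type*} [Field K] (t : K) : K⟦X⟧ :=
  PowerSeries.mk fun n =>
    (∑ F : FlagPointedCyclicHypertree (Fin n), t ^ F.1.1.rank) / (n.factorial : K)

/-- The pair `(A, z)` of formal power series in the indeterminate `B` (which is `PowerSeries.X`)
solves the system `A = -(1/t) ln (B / z)`, `B = z - t z (exp z - 1)`.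
For the composite `exp z` to exist as a formal power series, `z` has no constant term;
the series `q` is the quotient `B / z`, and its logarithm exists because its constant term is `1`. -/
def IsSolution {K : Type*} [Field K] [CharZero K] (t : K) (A z : K⟦X⟧) : Prop :=
  PowerSeries.constantCoeff z = 0 ∧
  (∃ q : K⟦X⟧, q * z = PowerSeries.X ∧ PowerSeries.constantCoeff q = 1 ∧
    A = -(1 / t) • PowerSeries.logOf q) ∧
  PowerSeries.X = z - t • (z * ((PowerSeries.exp K).subst z - 1))

end HypertreeSeries

/-!
Rooting a hypertree at a vertex `r` gives every other vertex a parent edge and every edge a gate,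
its vertex closest to `r`. After a numbering of the edges, a hypertree is thus a surjection from
`V \ {r}` onto the edges, together with a choice of gates that produces no circuit. Choosing the
gate of one edge and merging its block into the one of the gate leads, by induction, to a weighted
Cayley formula: for a given surjection onto `k + 1` edges, the number of admissible choices of gates
with prescribed vertex degrees is a multinomial coefficient. It cancels against the number
`∏ v, (deg v - 1)!` of cyclic structures, so that the number of cyclic hypertrees only involves the
number of surjections, a coefficient of `(exp X - 1) ^ (k + 1)`, and the number of multisets of `k`
vertices, a coefficient of `(1 - X) ^ (-|V|)`. Summing over `k` yields a coefficient of a power of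
`(1 - t (exp X - 1))⁻¹`, which Lagrange inversion identifies with a coefficient of the solution of
the system.
-/

namespace HypertreeSeries

open Finset

section Joined

variable {V : Type*} {E F : Finset (Finset V)} {r u v w : V}

theorem Joined.symm (h : Joined E v w) : Joined E w v := by
  induction h with
  | refl => exact .refl
  | tail _ hab ih =>
    obtain ⟨e, he, ha, hb⟩ := hab
    exact .head ⟨e, he, hb, ha⟩ ih

theorem Joined.trans (h : Joined E u v) (h' : Joined E v w) : Joined E u w :=
  Relation.ReflTransGen.trans h h'

theorem Joined.mono (hEF : E ⊆ F) (h : Joined E v w) : Joined F v w :=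
  Relation.ReflTransGen.mono (fun _ _ ⟨e, he, h⟩ => ⟨e, hEF he, h⟩) _ _ h

theorem Joined.of_mem {e : Finset V} (he : e ∈ E) (hv : v ∈ e) (hw : w ∈ e) : Joined E v w :=
  .single ⟨e, he, hv, hw⟩

variable [DecidableEq V]

theorem Joined.erase_or_exists_mem (e : Finset V) (h : Joined E v w) :
    Joined (E.erase e) v w ∨ ∃ u ∈ e, Joined (E.erase e) v u := by
  induction h with
  | refl => exact .inl .refl
  | @tail a b _ hab ih =>
    refine ih.elim (fun hva => ?_) .inr
    obtain ⟨e', he', ha, hb⟩ := hab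
    by_cases hee' : e' = e
    · exact .inr ⟨a, hee' ▸ ha, hva⟩
    · exact .inl (hva.trans (.of_mem (mem_erase.mpr ⟨hee', he'⟩) ha hb))

theorem Joined.exists_joined_filter_notMem (h : Joined E r v) (hrv : r ≠ v) :
    ∃ e ∈ E, v ∈ e ∧ ∃ u ∈ e, u ≠ v ∧ Joined {e ∈ E | v ∉ e} r u := by
  induction h using Relation.ReflTransGen.head_induction_on with
  | refl => exact absurd rfl hrv
  | @head r a hra _ ih =>
    obtain ⟨e, he, hr, ha⟩ := hra
    by_cases hve : v ∈ e
    · exact ⟨e, he, hve, r, hr, hrv, .refl⟩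
    · obtain ⟨e', he', hve', u, hu, huv, hau⟩ := ih fun hav => hve (hav ▸ ha)
      exact ⟨e', he', hve', u, hu, huv, .head ⟨e, mem_filter.mpr ⟨he, hve⟩, hr, ha⟩ hau⟩

end Joined

section Cycles

variable {V : Type*} {E : Finset (Finset V)} {v w : V}

/-- The primal graph (or `2`-section) of a hypergraph: two distinct vertices are adjacent if some
edge contains both of them. It gives access to shortest paths. -/
def primalGraph (E : Finset (Finset V)) : SimpleGraph V where
  Adj v w := v ≠ w ∧ ∃ e ∈ E, v ∈ e ∧ w ∈ e
  symm := ⟨fun _ _ ⟨hne, e, he, hv, hw⟩ => ⟨hne.symm, e, he, hw, hv⟩⟩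
  loopless := ⟨fun _ h => h.1 rfl⟩

theorem primalGraph_dist_le_one {e : Finset V} (he : e ∈ E) (hv : v ∈ e) (hw : w ∈ e) :
    (primalGraph E).dist v w ≤ 1 := by
  by_cases hvw : v = w
  · simp [hvw]
  · have hadj : (primalGraph E).Adj v w := ⟨hvw, e, he, hv, hw⟩
    exact (SimpleGraph.dist_eq_one_iff_adj.mpr hadj).le

theorem Joined.reachable_primalGraph (h : Joined E v w) : (primalGraph E).Reachable v w := by
  induction h with
  | refl => exact .refl _
  | @tail a b _ hab ih =>
    obtain ⟨e, he, ha, hb⟩ := hab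
    by_cases heq : a = b
    · exact heq ▸ ih
    · have hadj : (primalGraph E).Adj a b := ⟨heq, e, he, ha, hb⟩
      exact ih.trans hadj.reachable

theorem Joined.exists_path (h : Joined E v w) (hvw : v ≠ w) :
    ∃ (k : ℕ) (p : Fin (k + 2) → V) (d : Fin (k + 1) → Finset V),
      Function.Injective p ∧ Function.Injective d ∧ p 0 = v ∧ p (Fin.last _) = w ∧
        ∀ i, d i ∈ E ∧ p i.castSucc ∈ d i ∧ p i.succ ∈ d i := by
  obtain ⟨q, hq⟩ := h.reachable_primalGraph.exists_walk_length_eq_dist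
  obtain ⟨k, hk⟩ : ∃ k, q.length = k + 1 :=
    Nat.exists_eq_succ_of_ne_zero fun h0 => hvw (SimpleGraph.Walk.eq_of_length_eq_zero h0)
  have hstep : ∀ i : Fin (k + 1), ∃ e ∈ E, q.getVert i ∈ e ∧ q.getVert (i + 1) ∈ e := fun i =>
    (q.adj_getVert_succ (i := i) (by omega)).2
  choose d hdE hd hd' using hstep
  -- an edge used twice would be a shortcut
  have hd_ne : ∀ i j, i < j → d i ≠ d j := by
    intro i j hij heq
    have hshort := primalGraph_dist_le_one (hdE i) (hd i) (heq ▸ hd' j)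
    have hreach : (primalGraph E).Reachable (q.getVert i) (q.getVert (j + 1)) :=
      (Joined.of_mem (hdE i) (hd i) (heq ▸ hd' j)).reachable_primalGraph
    obtain ⟨s, hs⟩ := hreach.exists_walk_length_eq_dist
    have hle := SimpleGraph.dist_le ((q.take i).append (s.append (q.drop (j + 1))))
    simp only [SimpleGraph.Walk.length_append, SimpleGraph.Walk.take_length,
      SimpleGraph.Walk.drop_length] at hle
    omega
  refine ⟨k, fun i => q.getVert i, d, fun i j hij => ?_, fun i j hij => ?_, q.getVert_zero, ?_,
    fun i => ⟨hdE i, hd i, hd' i⟩⟩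
  · exact Fin.ext ((q.isPath_of_length_eq_dist hq).getVert_injOn (by simp; omega) (by simp; omega)
      hij)
  · by_contra hne
    rcases lt_or_gt_of_ne hne with h | h
    · exact hd_ne i j h hij
    · exact hd_ne j i h hij.symm
  · simp [← hk]

variable [DecidableEq V]

theorem hasCycle_of_joined_erase {e : Finset V} (he : e ∈ E) (hv : v ∈ e) (hw : w ∈ e)
    (hvw : v ≠ w) (h : Joined (E.erase e) v w) : HasCycle E := by
  obtain ⟨k, p, d, hp, hd, rfl, rfl, hpd⟩ := h.exists_path hvw
  refine ⟨k, p, Fin.snoc d e, hp, Fin.snoc_injective_iff.mpr ⟨hd, ?_⟩, fun i => ?_⟩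
  · rintro ⟨i, rfl⟩
    exact notMem_erase _ _ (hpd i).1
  · induction i using Fin.lastCases with
    | last => simp [he, hv, hw]
    | cast i => simpa [Fin.coeSucc_eq_succ] using ⟨mem_of_mem_erase (hpd i).1, (hpd i).2⟩

theorem HasCycle.exists_joined_erase (h : HasCycle E) :
    ∃ e ∈ E, ∃ v ∈ e, ∃ w ∈ e, v ≠ w ∧ Joined (E.erase e) v w := by
  obtain ⟨k, v, e, hv, he, hve⟩ := h
  have hedge : ∀ i, i ≠ 0 → Joined (E.erase (e 0)) (v i) (v (i + 1)) := fun i hi =>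
    .of_mem (mem_erase.mpr ⟨he.ne hi, (hve i).1⟩) (hve i).2.1 (hve i).2.2
  have hjoined : ∀ i : Fin (k + 1), Joined (E.erase (e 0)) (v 1) (v i.succ) := by
    intro i
    induction i using Fin.induction with
    | zero => exact .refl
    | succ i ih =>
      refine ih.trans ?_
      rw [← Fin.coeSucc_eq_succ (a := i.succ), ← Fin.succ_castSucc]
      exact hedge _ (Fin.succ_ne_zero _)
  refine ⟨e 0, (hve 0).1, v 1, by simpa using (hve 0).2.2, v 0, (hve 0).2.1, hv.ne (by simp), ?_⟩
  have hlast := (hjoined (Fin.last k)).trans (hedge _ (Fin.succ_ne_zero _))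
  simpa using hlast

end Cycles

section WeightedCayley

variable {V B C : Type*}

/-- The parent relation of the structure in which the vertex `v` belongs to the block `β v` (to no
block, and thus is a root, if `β v = none`), and every block `b` hangs from the vertex `f b`.
It is well-founded if and only if the blocks form a forest. -/
def IsParent (β : V → Option B) (f : B → V) (u v : V) : Prop :=
  ∃ b, β v = some b ∧ f b = u

/-- The map to the blocks obtained from `γ` by merging the block `none` into the one of `v₀`;
if `v₀` is a root or lies in the block `none` itself, the vertices of that block become roots. -/
def mergeBlock (γ : V → Option (Option C)) (v₀ v : V) : Option C :=
  (γ v).bind fun b => b.elim (γ v₀).join some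

theorem mergeBlock_eq_some_iff {γ : V → Option (Option C)} {v₀ v : V} {c : C} :
    mergeBlock γ v₀ v = some c ↔
      γ v = some (some c) ∨ γ v = some none ∧ γ v₀ = some (some c) := by
  rcases hv : γ v with _ | _ | b <;> simp [mergeBlock, hv, Option.join_eq_some_iff]

theorem mergeBlock_eq_none_iff {γ : V → Option (Option C)} {v₀ v : V} (hv₀ : γ v₀ ≠ some none) :
    mergeBlock γ v₀ v = none ↔ γ v = none ∨ γ v = some none ∧ γ v₀ = none := by
  rcases hv : γ v with _ | _ | b <;> simp [mergeBlock, hv, Option.join_eq_none_iff, hv₀]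

theorem ne_some_of_wellFounded_isParent {β : V → Option B} {f : B → V}
    (h : WellFounded (IsParent β f)) (b : B) : β (f b) ≠ some b := fun hb =>
  h.irrefl.irrefl (f b) ⟨b, hb, rfl⟩

theorem wellFounded_isParent_option_iff {γ : V → Option (Option C)} {f : Option C → V} :
    WellFounded (IsParent γ f) ↔ γ (f none) ≠ some none ∧
      WellFounded (IsParent (mergeBlock γ (f none)) (f ∘ some)) := by
  refine ⟨fun h => ⟨ne_some_of_wellFounded_isParent h none, ?_⟩, ?_⟩
  · refine Subrelation.wf ?_ h.transGen
    rintro _ v ⟨c, hc, rfl⟩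
    rcases mergeBlock_eq_some_iff.mp hc with hv | ⟨hv, hnone⟩
    · exact .single ⟨_, hv, rfl⟩
    · exact .tail (.single ⟨_, hnone, rfl⟩) ⟨_, hv, rfl⟩
  · rintro ⟨hnone, h⟩
    refine ⟨fun v => h.induction v fun v ih => ⟨_, ?_⟩⟩
    rintro _ ⟨_ | c, hv, rfl⟩
    · refine ⟨_, ?_⟩
      rintro _ ⟨_ | c, hc, rfl⟩
      · exact absurd hc hnone
      · exact ih _ ⟨c, mergeBlock_eq_some_iff.mpr (.inr ⟨hv, hc⟩), rfl⟩
    · exact ih _ ⟨c, mergeBlock_eq_some_iff.mpr (.inl hv), rfl⟩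

theorem isParent_map_equiv (β : V → Option B) (e : B ≃ C) (f : C → V) :
    IsParent (fun v => (β v).map e) f = IsParent β (f ∘ e) := by
  ext u v
  simp [IsParent, Option.map_eq_some_iff]

variable {R : Type*} [CommSemiring R] [Fintype V] [Fintype B] [DecidableEq B] [Fintype C]
  [DecidableEq C]

open Classical in
/-- The enumerator of the ways to hang the blocks of `β` from vertices so as to obtain a forest,
the variable `x v` marking the blocks that hang from `v`. -/
noncomputable def forestEnumerator (x : V → R) (β : V → Option B) : R :=
  ∑ f : B → V with WellFounded (IsParent β f), ∏ b, x (f b)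

theorem forestEnumerator_map_equiv (x : V → R) (β : V → Option B) (e : B ≃ C) :
    forestEnumerator x (fun v => (β v).map e) = forestEnumerator x β := by
  classical
  simp only [forestEnumerator, sum_filter, isParent_map_equiv]
  refine Fintype.sum_equiv (e.arrowCongr (Equiv.refl V)).symm _ _ fun f => ?_
  have hprod : ∏ b, x ((f ∘ e) b) = ∏ c, x (f c) := e.prod_comp fun c => x (f c)
  rw [← hprod]
  rfl

theorem forestEnumerator_of_isEmpty [IsEmpty B] (x : V → R) (β : V → Option B) :
    forestEnumerator x β = 1 := by
  have hwf (f : B → V) : WellFounded (IsParent β f) := ⟨fun v => ⟨v, fun _ ⟨b, _⟩ => isEmptyElim b⟩⟩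
  simp [forestEnumerator, hwf]

open Classical in
theorem forestEnumerator_option (x : V → R) (γ : V → Option (Option C)) :
    forestEnumerator x γ
      = ∑ v₀ with γ v₀ ≠ some none, x v₀ * forestEnumerator x (mergeBlock γ v₀) := by
  simp only [forestEnumerator, sum_filter]
  refine (Fintype.sum_equiv Equiv.piOptionEquivProd _ (fun p : V × (C → V) =>
    if γ p.1 ≠ some none ∧ WellFounded (IsParent (mergeBlock γ p.1) p.2)
      then x p.1 * ∏ c, x (p.2 c) else 0) fun f => ?_).trans ?_
  · simp only [wellFounded_isParent_option_iff, Fintype.prod_option]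
    rfl
  · rw [Fintype.sum_prod_type]
    refine sum_congr rfl fun v₀ _ => ?_
    split_ifs with hv₀ <;> simp [hv₀, mul_sum]

omit [Fintype C] in
open Classical in
theorem sum_mergeBlock_eq_none (x : V → R) {γ : V → Option (Option C)} {v₀ : V}
    (hv₀ : γ v₀ ≠ some none) :
    ∑ v with mergeBlock γ v₀ v = none, x v
      = ∑ v with γ v = none, x v + if γ v₀ = none then ∑ v with γ v = some none, x v else 0 := by
  simp only [mergeBlock_eq_none_iff hv₀]
  split_ifs with h
  · simp only [h, and_true]
    rw [filter_or, sum_union (disjoint_filter.mpr fun v _ hv => by simp [hv])]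
  · simp [h]

omit [Fintype C] in
open Classical in
theorem sum_mul_sum_mergeBlock_eq_none (x : V → R) (γ : V → Option (Option C)) :
    ∑ v₀ with γ v₀ ≠ some none, x v₀ * ∑ v with mergeBlock γ v₀ v = none, x v
      = (∑ v with γ v = none, x v) * ∑ v, x v := by
  have hroots : ∑ v₀ with γ v₀ ≠ some none,
      (if γ v₀ = none then x v₀ * ∑ v with γ v = some none, x v else 0)
        = (∑ v with γ v = none, x v) * ∑ v with γ v = some none, x v := by
    rw [← sum_filter, filter_filter, sum_mul]
    refine sum_congr (filter_congr fun v _ => ?_) fun _ _ => rfl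
    simp +contextual
  calc ∑ v₀ with γ v₀ ≠ some none, x v₀ * ∑ v with mergeBlock γ v₀ v = none, x v
    _ = ∑ v₀ with γ v₀ ≠ some none, (x v₀ * ∑ v with γ v = none, x v +
          if γ v₀ = none then x v₀ * ∑ v with γ v = some none, x v else 0) := by
      refine sum_congr rfl fun v₀ hv₀ => ?_
      rw [sum_mergeBlock_eq_none x (mem_filter.mp hv₀).2, mul_add, mul_ite, mul_zero]
    _ = (∑ v with γ v = none, x v) *
          (∑ v with γ v = some none, x v + ∑ v with γ v ≠ some none, x v) := by
      rw [sum_add_distrib, hroots, ← sum_mul, mul_comm, ← mul_add, add_comm]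
    _ = (∑ v with γ v = none, x v) * ∑ v, x v := by rw [sum_filter_add_sum_filter_not]

theorem forestEnumerator_eq (x : V → R) (β : V → Option B) {k : ℕ}
    (hB : Fintype.card B = k + 1) :
    forestEnumerator x β = (∑ v with β v = none, x v) * (∑ v, x v) ^ k := by
  induction k generalizing B with
  | zero =>
    obtain ⟨_⟩ := Fintype.card_eq_one_iff_nonempty_unique.mp hB
    have : IsEmpty {b : B // b ≠ default} := ⟨fun b => b.2 (Unique.eq_default _)⟩
    have hne (v : V) : (β v).map (Equiv.optionSubtypeNe (default : B)).symm ≠ some none ↔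
        β v = none := by
      rcases β v with _ | b
      · simp
      · simp [Unique.eq_default b]
    rw [← forestEnumerator_map_equiv x β (Equiv.optionSubtypeNe default).symm,
      forestEnumerator_option]
    simp [forestEnumerator_of_isEmpty, hne]
  | succ k ih =>
    obtain ⟨b₀⟩ : Nonempty B := Fintype.card_pos_iff.mp (by omega)
    have hcard : Fintype.card {b // b ≠ b₀} = k + 1 := by simp [Fintype.card_subtype_compl, hB]
    have hnone (v : V) : (β v).map (Equiv.optionSubtypeNe b₀).symm = none ↔ β v = none := by simp
    rw [← forestEnumerator_map_equiv x β (Equiv.optionSubtypeNe b₀).symm,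
      forestEnumerator_option]
    simp only [ih _ hcard, ← mul_assoc, ← sum_mul, sum_mul_sum_mergeBlock_eq_none, hnone]
    rw [mul_assoc, ← pow_succ']

end WeightedCayley

section Arborescences

variable {V B : Type*}

/-- The vertex set is partitioned by `β` into the root `r` and nonempty blocks indexed by `B`. -/
structure IsRootedPartition (r : V) (β : V → Option B) : Prop where
  eq_none_iff : ∀ v, β v = none ↔ v = r
  exists_eq_some : ∀ b, ∃ v, β v = some b

/-- The blocks of a rooted partition `β`, each block `b` hanging from the vertex `f b`, form a tree
with root `r`. This encodes a hypertree with edges labelled by `B`, see `blockEdge`. -/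
structure IsArborescence (r : V) (β : V → Option B) (f : B → V) : Prop
    extends IsRootedPartition r β where
  wellFounded : WellFounded (IsParent β f)

theorem isArborescence_iff {r : V} {β : V → Option B} {f : B → V} :
    IsArborescence r β f ↔ IsRootedPartition r β ∧ WellFounded (IsParent β f) :=
  ⟨fun h => ⟨h.toIsRootedPartition, h.wellFounded⟩, fun h => ⟨h.1, h.2⟩⟩

variable [Fintype V] [DecidableEq V] [DecidableEq B]

/-- The edge consisting of the vertices of the block `b` and of the vertex from which it hangs. -/
def blockEdge (β : V → Option B) (f : B → V) (b : B) : Finset V :=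
  insert (f b) (univ.filter fun v => β v = some b)

variable {β β' : V → Option B} {f f' : B → V} {r v w : V} {b : B}

theorem mem_blockEdge : v ∈ blockEdge β f b ↔ v = f b ∨ β v = some b := by
  simp [blockEdge]

theorem self_mem_blockEdge : f b ∈ blockEdge β f b := mem_insert_self _ _

theorem mem_blockEdge_of_eq_some (h : β v = some b) : v ∈ blockEdge β f b :=
  mem_blockEdge.mpr (.inr h)

theorem reflTransGen_isParent_of_mem_blockEdge (hvw : Relation.ReflTransGen (IsParent β f) v w)
    (hw : w ∈ blockEdge β f b) (hne : β w = some b → v ≠ w) :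
    Relation.ReflTransGen (IsParent β f) v (f b) := by
  rcases mem_blockEdge.mp hw with rfl | hwb
  · exact hvw
  · rcases hvw.cases_tail with heq | ⟨u, hvu, c, hwc, rfl⟩
    · exact absurd heq.symm (hne hwb)
    · rwa [Option.some.inj (hwb.symm.trans hwc)]

variable [Fintype B]

theorem reflTransGen_isParent_of_joined_erase (hv : β v = some b)
    (hj : Joined ((univ.image (blockEdge β f)).erase (blockEdge β f b)) v w) :
    Relation.ReflTransGen (IsParent β f) v w := by
  induction hj with
  | refl => exact .refl
  | @tail u w _ huw ih =>
    obtain ⟨e, he, hu, hw⟩ := huw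
    obtain ⟨hne, he⟩ := mem_erase.mp he
    obtain ⟨c, -, rfl⟩ := mem_image.mp he
    have hvc : Relation.ReflTransGen (IsParent β f) v (f c) :=
      reflTransGen_isParent_of_mem_blockEdge ih hu fun huc hvu =>
        hne (Option.some.inj (huc.symm.trans (hvu ▸ hv)) ▸ rfl)
    rcases mem_blockEdge.mp hw with rfl | hwc
    · exact hvc
    · exact hvc.tail ⟨c, hwc, rfl⟩

theorem not_joined_erase_blockEdge (h : WellFounded (IsParent β f)) (hv : β v = some b)
    (hw : w ∈ blockEdge β f b) (hvw : v ≠ w) :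
    ¬ Joined ((univ.image (blockEdge β f)).erase (blockEdge β f b)) v w := fun hj =>
  have hfb : Relation.ReflTransGen (IsParent β f) v (f b) :=
    reflTransGen_isParent_of_mem_blockEdge (reflTransGen_isParent_of_joined_erase hv hj) hw
      fun _ => hvw
  h.transGen.irrefl.irrefl v (.tail' hfb ⟨b, hv, rfl⟩)

namespace IsArborescence

omit [Fintype B] in
theorem blockEdge_injective (h : IsArborescence r β f) : Function.Injective (blockEdge β f) := by
  intro b b' heq
  by_contra hne
  -- otherwise each of the two blocks would hang from a vertex of the other
  have hpar : ∀ {b b'}, b ≠ b' → blockEdge β f b = blockEdge β f b' → ∀ v, β v = some b →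
      f b' = v := by
    intro b b' hne heq v hv
    rcases mem_blockEdge.mp (heq ▸ mem_blockEdge_of_eq_some hv) with h' | h'
    · exact h'.symm
    · exact absurd (Option.some.inj (hv.symm.trans h')) hne
  obtain ⟨u, hu⟩ := h.exists_eq_some b
  obtain ⟨u', hu'⟩ := h.exists_eq_some b'
  exact h.wellFounded.asymmetric _ _ ⟨b', hu', hpar hne heq u hu⟩
    ⟨b, hu, hpar (Ne.symm hne) heq.symm u' hu'⟩

theorem isHypergraph [Nonempty B] (h : IsArborescence r β f) :
    IsHypergraph (univ.image (blockEdge β f)) := by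
  refine ⟨univ_nonempty.image _, fun e he => ?_⟩
  obtain ⟨b, -, rfl⟩ := mem_image.mp he
  obtain ⟨v, hv⟩ := h.exists_eq_some b
  refine one_lt_card.mpr ⟨f b, self_mem_blockEdge, v, mem_blockEdge_of_eq_some hv, ?_⟩
  rintro rfl
  exact ne_some_of_wellFounded_isParent h.wellFounded b hv

theorem joined_root (h : IsArborescence r β f) (v : V) :
    Joined (univ.image (blockEdge β f)) v r := by
  induction v using h.wellFounded.induction with
  | _ v ih =>
    rcases hv : β v with _ | b
    · rw [(h.eq_none_iff v).mp hv]
      exact .refl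
    · exact (Joined.of_mem (mem_image_of_mem _ (mem_univ b)) (mem_blockEdge_of_eq_some hv)
        self_mem_blockEdge).trans (ih _ ⟨b, hv, rfl⟩)

theorem not_hasCycle (h : IsArborescence r β f) : ¬ HasCycle (univ.image (blockEdge β f)) := by
  intro hcycle
  obtain ⟨e, he, v, hv, w, hw, hvw, hj⟩ := hcycle.exists_joined_erase
  obtain ⟨b, -, rfl⟩ := mem_image.mp he
  rcases mem_blockEdge.mp hv with hvb | hvb
  · rcases mem_blockEdge.mp hw with hwb | hwb
    · exact hvw (hvb.trans hwb.symm)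
    · exact not_joined_erase_blockEdge h.wellFounded hwb hv hvw.symm hj.symm
  · exact not_joined_erase_blockEdge h.wellFounded hvb hw hvw hj

/-- The hypertree whose edges are the sets `blockEdge β f b`. -/
def hypertree [Nonempty B] (h : IsArborescence r β f) : Hypertree V where
  edges := univ.image (blockEdge β f)
  isHypergraph := h.isHypergraph
  connected v w := (h.joined_root v).trans (h.joined_root w).symm
  acyclic := h.not_hasCycle

/-- The labelling of the edges of `h.hypertree` by the blocks. -/
noncomputable def edgeEquiv [Nonempty B] (h : IsArborescence r β f) :
    B ≃ h.hypertree.edges :=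
  Equiv.ofBijective (fun b => ⟨blockEdge β f b, mem_image_of_mem _ (mem_univ b)⟩)
    ⟨fun _ _ heq => h.blockEdge_injective (congrArg Subtype.val heq), fun ⟨e, he⟩ => by
      obtain ⟨b, -, rfl⟩ := mem_image.mp he
      exact ⟨b, rfl⟩⟩

omit [Fintype B] in
theorem eq_of_blockEdge_eq (h : IsArborescence r β f) (h' : IsArborescence r β' f')
    (heq : blockEdge β f = blockEdge β' f') : β = β' ∧ f = f' := by
  have hmem (b : B) (v : V) : v = f b ∨ β v = some b ↔ v = f' b ∨ β' v = some b := by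
    rw [← mem_blockEdge, ← mem_blockEdge, heq]
  have hne := ne_some_of_wellFounded_isParent h.wellFounded
  have hf (b : B) (hβ : β (f b) = β' (f b)) : f b = f' b :=
    ((hmem b (f b)).mp (.inl rfl)).resolve_right (hβ ▸ hne b)
  have hβ (v : V) : β v = β' v := by
    induction v using h.wellFounded.induction with
    | _ v ih =>
      rcases hv : β v with _ | b
      · exact ((h'.eq_none_iff v).mpr ((h.eq_none_iff v).mp hv)).symm
      · rcases (hmem b v).mp (.inr hv) with hvf | hvb
        · have hfb := hf b (ih _ ⟨b, hv, rfl⟩)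
          exact absurd ((hvf.trans hfb.symm) ▸ hv) (hne b)
        · exact hvb.symm
  exact ⟨funext hβ, funext fun b => hf b (hβ _)⟩

end IsArborescence

end Arborescences

section Gates

variable {V : Type*} [DecidableEq V] {T : Hypertree V} {r u u' v w : V} {e e' : Finset V}

theorem Hypertree.eq_of_joined_erase (T : Hypertree V) (he : e ∈ T.edges) (hv : v ∈ e)
    (hw : w ∈ e) (h : Joined (T.edges.erase e) v w) : v = w := by
  by_contra hvw
  exact T.acyclic (hasCycle_of_joined_erase he hv hw hvw h)

/-- The vertex `u` of the edge `e` is the one through which `e` is reached from `r`. -/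
def IsGate (T : Hypertree V) (r : V) (e : Finset V) (u : V) : Prop :=
  u ∈ e ∧ Joined (T.edges.erase e) r u

theorem exists_isGate (T : Hypertree V) (r : V) (he : e ∈ T.edges) : ∃ u, IsGate T r e u := by
  obtain ⟨w, hw⟩ := card_pos.mp (zero_lt_two.trans_le (T.isHypergraph.2 e he))
  rcases (T.connected r w).erase_or_exists_mem e with h | h
  · exact ⟨w, hw, h⟩
  · exact h

theorem IsGate.eq_of_joined (hu : IsGate T r e u) (he : e ∈ T.edges) (hv : v ∈ e)
    (h : Joined (T.edges.erase e) r v) : v = u :=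
  T.eq_of_joined_erase he hv hu.1 (h.symm.trans hu.2)

theorem exists_isGate_ne (T : Hypertree V) (hvr : v ≠ r) :
    ∃ e ∈ T.edges, v ∈ e ∧ ∃ u, u ≠ v ∧ IsGate T r e u := by
  obtain ⟨e, he, hv, u, hu, huv, h⟩ := (T.connected r v).exists_joined_filter_notMem hvr.symm
  refine ⟨e, he, hv, u, huv, hu, h.mono fun e' he' => ?_⟩
  obtain ⟨he', hve'⟩ := mem_filter.mp he'
  exact mem_erase.mpr ⟨fun heq => hve' (heq ▸ hv), he'⟩

theorem IsGate.edge_unique (hu : IsGate T r e u) (hu' : IsGate T r e' u') (he : e ∈ T.edges)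
    (he' : e' ∈ T.edges) (hv : v ∈ e) (hvu : v ≠ u) (hv' : v ∈ e') (hvu' : v ≠ u') : e = e' := by
  by_contra hne
  have hsub : (T.edges.erase e').erase e ⊆ T.edges.erase e :=
    erase_subset_erase _ (erase_subset _ _)
  rcases hu'.2.erase_or_exists_mem e with h | ⟨w, hw, h⟩
  · exact hvu (hu.eq_of_joined he hv ((h.mono hsub).trans
      (.of_mem (mem_erase.mpr ⟨Ne.symm hne, he'⟩) hu'.1 hv')))
  · exact hvu' (hu'.eq_of_joined he' hv' ((h.mono (erase_subset _ _)).trans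
      (.of_mem (mem_erase.mpr ⟨hne, he⟩) hw hv)))

open Classical in
/-- The edges of `T` that separate `v` from `r`. -/
noncomputable def separatingEdges (T : Hypertree V) (r v : V) : Finset (Finset V) :=
  {e ∈ T.edges | ¬ Joined (T.edges.erase e) r v}

theorem IsGate.separatingEdges_ssubset (hu : IsGate T r e u) (he : e ∈ T.edges) (hv : v ∈ e)
    (hvu : v ≠ u) : separatingEdges T r u ⊂ separatingEdges T r v := by
  classical
  have hev : e ∈ separatingEdges T r v :=
    mem_filter.mpr ⟨he, fun h => hvu (hu.eq_of_joined he hv h)⟩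
  have heu : e ∉ separatingEdges T r u := fun h => (mem_filter.mp h).2 hu.2
  refine ssubset_iff_of_subset (fun e' he' => ?_) |>.mpr ⟨e, hev, heu⟩
  have hne : e ≠ e' := fun heq => heu (heq ▸ he')
  obtain ⟨he', h'⟩ := mem_filter.mp he'
  exact mem_filter.mpr ⟨he', fun h =>
    h' (h.trans (.of_mem (mem_erase.mpr ⟨hne, he⟩) hv hu.1))⟩

theorem exists_option_eq_some_iff {B : Type*} {p : B → Prop} (hp : ∀ b b', p b → p b' → b = b') :
    ∃ o : Option B, ∀ b, o = some b ↔ p b := by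
  by_cases h : ∃ b, p b
  · obtain ⟨b, hb⟩ := h
    exact ⟨some b, fun b' => ⟨fun heq => Option.some.inj heq ▸ hb,
      fun hb' => congrArg some (hp b b' hb hb')⟩⟩
  · exact ⟨none, fun b => ⟨nofun, fun hb => absurd ⟨b, hb⟩ h⟩⟩

variable [Fintype V] {B : Type*} [DecidableEq B]

theorem Hypertree.exists_isArborescence (T : Hypertree V) (r : V) (d : B ≃ T.edges) :
    ∃ β f, IsArborescence r β f ∧ ∀ b, blockEdge β f b = d b := by
  choose f hf using fun b => exists_isGate T r (d b).2
  choose β hβ using fun v => exists_option_eq_some_iff fun b b' (hb : v ∈ (d b).1 ∧ v ≠ f b) hb' =>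
    d.injective (Subtype.ext
      ((hf b).edge_unique (hf b') (d b).2 (d b').2 hb.1 hb.2 hb'.1 hb'.2))
  refine ⟨β, f, ⟨⟨fun v => ⟨fun hv => ?_, ?_⟩, fun b => ?_⟩, ?_⟩, fun b => ?_⟩
  · by_contra hvr
    obtain ⟨e, he, hve, u, huv, hu⟩ := exists_isGate_ne T hvr
    obtain ⟨b, rfl⟩ : ∃ b, (d b).1 = e := ⟨d.symm ⟨e, he⟩, by simp⟩
    have hvf : v ≠ f b := fun h => huv (((hf b).eq_of_joined he hu.1 hu.2).trans h.symm)
    exact absurd (hv.symm.trans ((hβ v b).mpr ⟨hve, hvf⟩)) (by simp)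
  · rintro rfl
    refine Option.eq_none_iff_forall_ne_some.mpr fun b hb => ?_
    obtain ⟨hvb, hne⟩ := (hβ v b).mp hb
    exact hne ((hf b).eq_of_joined (d b).2 hvb .refl)
  · obtain ⟨v, hv, hne⟩ := exists_mem_ne (T.isHypergraph.2 _ (d b).2) (f b)
    exact ⟨v, (hβ v b).mpr ⟨hv, hne⟩⟩
  · refine Subrelation.wf ?_ (InvImage.wf (separatingEdges T r) wellFounded_lt)
    rintro _ v ⟨b, hb, rfl⟩
    obtain ⟨hvb, hne⟩ := (hβ v b).mp hb
    exact (hf b).separatingEdges_ssubset (d b).2 hvb hne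
  · ext v
    rw [mem_blockEdge, hβ]
    by_cases h : v = f b
    · simp [h, (hf b).1]
    · simp [h]

end Gates

section DegreeEnumerator

variable {V B : Type*}

noncomputable instance [Finite V] : Fintype (Hypertree V) :=
  Fintype.ofFinite _

theorem Hypertree.edges_injective : Function.Injective (Hypertree.edges (V := V)) := by
  rintro ⟨_, _, _, _⟩ ⟨_, _, _, _⟩ rfl
  rfl

theorem Hypertree.edgeLabelling_injective :
    Function.Injective fun (p : (T : Hypertree V) × (B ≃ T.edges)) (b : B) =>
      (p.2 b : Finset V) := by
  rintro ⟨T, d⟩ ⟨T', d'⟩ h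
  have hrange (T : Hypertree V) (d : B ≃ T.edges) :
      Set.range (fun b => (d b : Finset V)) = T.edges :=
    (d.surjective.range_comp Subtype.val).trans Subtype.range_coe
  obtain rfl : T = T' := Hypertree.edges_injective <| coe_injective <| by
    rw [← hrange T d, ← hrange T' d']
    exact congrArg Set.range h
  exact congrArg (Sigma.mk T) (Equiv.ext fun b => Subtype.ext (congrFun h b))

theorem sum_edgeLabelled [Finite V] [DecidableEq V] [Fintype B] [DecidableEq B] {R : Type*}
    [CommSemiring R] (F : Hypertree V → R) :
    ∑ p : (T : Hypertree V) × (B ≃ T.edges), F p.1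
      = (Fintype.card B).factorial * ∑ T : Hypertree V with #T.edges = Fintype.card B, F T := by
  rw [Fintype.sum_sigma, mul_sum, sum_filter]
  refine sum_congr rfl fun T _ => ?_
  change ∑ _ : B ≃ T.edges, F T = _
  rw [sum_const, card_univ, nsmul_eq_mul]
  split_ifs with hT
  · rw [Fintype.card_equiv (Fintype.equivOfCardEq (by simp [hT]))]
  · have : IsEmpty (B ≃ T.edges) := ⟨fun e => hT (by simp [Fintype.card_congr e])⟩
    simp

variable [Fintype V] [DecidableEq V]

omit [DecidableEq V] in
theorem Hypertree.card_edges_lt (T : Hypertree V) : #T.edges < Fintype.card V := by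
  classical
  obtain ⟨e, he⟩ := T.isHypergraph.1
  obtain ⟨r, -⟩ := card_pos.mp (zero_lt_two.trans_le (T.isHypergraph.2 e he))
  obtain ⟨β, f, h, -⟩ := T.exists_isArborescence r (Equiv.refl _)
  have hsurj : Function.Surjective β := fun o => by
    rcases o with _ | b
    exacts [⟨r, (h.eq_none_iff r).mpr rfl⟩, h.exists_eq_some b]
  simpa using Fintype.card_le_of_surjective β hsurj

variable [Fintype B] [DecidableEq B]

/-- The edge-labelled hypertree encoded by an arborescence. -/
noncomputable def edgeLabelledHypertree [Nonempty B] {r : V}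
    (p : {p : (V → Option B) × (B → V) // IsArborescence r p.1 p.2}) :
    (T : Hypertree V) × (B ≃ T.edges) :=
  ⟨p.2.hypertree, p.2.edgeEquiv⟩

theorem edgeLabelledHypertree_bijective [Nonempty B] (r : V) :
    Function.Bijective (edgeLabelledHypertree (B := B) (r := r)) := by
  refine ⟨fun ⟨⟨β, f⟩, h⟩ ⟨⟨β', f'⟩, h'⟩ heq => ?_, fun ⟨T, d⟩ => ?_⟩
  · obtain ⟨rfl, rfl⟩ := h.eq_of_blockEdge_eq h'
      (congrArg (fun p (b : B) => (p.2 b : Finset V)) heq)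
    rfl
  · obtain ⟨β, f, h, hd⟩ := T.exists_isArborescence r d
    exact ⟨⟨⟨β, f⟩, h⟩, Hypertree.edgeLabelling_injective (funext hd)⟩

omit [Fintype V] in
/-- The number of edges of `T` containing the vertex `v`. -/
def Hypertree.degree (T : Hypertree V) (v : V) : ℕ := #{e ∈ T.edges | v ∈ e}

variable {R : Type*} [CommSemiring R]

theorem Hypertree.prod_pow_degree (T : Hypertree V) (x : V → R) :
    ∏ v, x v ^ T.degree v = ∏ e ∈ T.edges, ∏ v ∈ e, x v := by
  have hpow (v : V) : x v ^ T.degree v = ∏ e ∈ T.edges, if v ∈ e then x v else 1 := by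
    rw [degree, ← prod_filter, prod_const]
  simp only [hpow]
  rw [prod_comm]
  exact prod_congr rfl fun e _ => by simp [prod_ite_mem]

theorem IsRootedPartition.prod_blocks {r : V} {β : V → Option B} (h : IsRootedPartition r β)
    (x : V → R) : ∏ b, ∏ v with β v = some b, x v = ∏ v ∈ univ.erase r, x v := by
  have hblock (v : V) :
      ∏ b, (if β v = some b then x v else 1) = if v ∈ univ.erase r then x v else 1 := by
    rcases hv : β v with _ | b
    · simp [(h.eq_none_iff v).mp hv]
    · have hvr : v ≠ r := fun hvr => by simp [(h.eq_none_iff v).mpr hvr] at hv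
      simp [hvr]
  simp only [prod_filter]
  rw [prod_comm]
  simp only [hblock, prod_ite_mem, univ_inter]

theorem IsArborescence.prod_pow_degree_hypertree [Nonempty B] {r : V} {β : V → Option B}
    {f : B → V} (h : IsArborescence r β f) (x : V → R) :
    ∏ v, x v ^ h.hypertree.degree v = (∏ b, x (f b)) * ∏ v ∈ univ.erase r, x v := by
  have hblock (b : B) : ∏ v ∈ blockEdge β f b, x v = x (f b) * ∏ v with β v = some b, x v :=
    prod_insert fun hb =>
      ne_some_of_wellFounded_isParent h.wellFounded b (mem_filter.mp hb).2
  rw [Hypertree.prod_pow_degree, hypertree, prod_image h.blockEdge_injective.injOn]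
  simp only [hblock, prod_mul_distrib, h.prod_blocks]

open Classical in
theorem sum_isArborescence_prod (x : V → R) (r : V) {k : ℕ} (hB : Fintype.card B = k + 1) :
    ∑ p : {p : (V → Option B) × (B → V) // IsArborescence r p.1 p.2},
        (∏ b, x (p.1.2 b)) * ∏ v ∈ univ.erase r, x v
      = Nat.card {β : V → Option B // IsRootedPartition r β}
          * ((∏ v, x v) * (∑ v, x v) ^ k) := by
  have hforest (β : V → Option B) (hβ : IsRootedPartition r β) :
      forestEnumerator x β = x r * (∑ v, x v) ^ k := by
    rw [forestEnumerator_eq x β hB]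
    simp [hβ.eq_none_iff, filter_eq']
  calc
    _ = ∑ β : V → Option B with IsRootedPartition r β,
          forestEnumerator x β * ∏ v ∈ univ.erase r, x v := by
      rw [← sum_subtype (univ.filter fun p : (V → Option B) × (B → V) => IsArborescence r p.1 p.2)
        (by simp) fun p => (∏ b, x (p.2 b)) * ∏ v ∈ univ.erase r, x v, sum_filter,
        Fintype.sum_prod_type, sum_filter]
      refine sum_congr rfl fun β _ => ?_
      split_ifs with hβ <;> simp [forestEnumerator, isArborescence_iff, hβ, sum_filter, sum_mul]
    _ = Nat.card {β : V → Option B // IsRootedPartition r β}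
          * (x r * (∑ v, x v) ^ k * ∏ v ∈ univ.erase r, x v) := by
      rw [sum_congr rfl fun β hβ => by rw [hforest β (mem_filter.mp hβ).2], sum_const,
        Nat.card_eq_fintype_card, Fintype.card_subtype, nsmul_eq_mul]
    _ = _ := by
      rw [mul_right_comm, mul_prod_erase univ x (mem_univ r)]

theorem factorial_mul_sum_prod_pow_degree (x : V → R) (r : V) (k : ℕ) :
    (k + 1).factorial * ∑ T : Hypertree V with #T.edges = k + 1, ∏ v, x v ^ T.degree v
      = Nat.card {β : V → Option (Fin (k + 1)) // IsRootedPartition r β}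
          * ((∏ v, x v) * (∑ v, x v) ^ k) := by
  classical
  have hlabel := sum_edgeLabelled (B := Fin (k + 1)) fun T : Hypertree V => ∏ v, x v ^ T.degree v
  rw [Fintype.card_fin] at hlabel
  rw [← hlabel, ← sum_isArborescence_prod x r (Fintype.card_fin (k + 1))]
  refine (Fintype.sum_bijective edgeLabelledHypertree (edgeLabelledHypertree_bijective r) _ _
    fun p => ?_).symm
  exact (p.2.prod_pow_degree_hypertree x).symm

theorem factorial_mul_sum_degree (W : (V → ℕ) → ℕ) (r : V) (k : ℕ) :
    (k + 1).factorial * ∑ T : Hypertree V with #T.edges = k + 1, W T.degree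
      = Nat.card {β : V → Option (Fin (k + 1)) // IsRootedPartition r β}
          * ∑ s ∈ univ.piAntidiag k, Nat.multinomial univ s * W (s + 1) := by
  let L : MvPolynomial V ℕ →ₗ[ℕ] ℕ := (MvPolynomial.basisMonomials V ℕ).constr ℕ fun c => W c
  have hL (c : V → ℕ) : L (∏ v, MvPolynomial.X v ^ c v) = W c := by
    have hmonomial : ∏ v, MvPolynomial.X v ^ c v
        = MvPolynomial.basisMonomials V ℕ (Finsupp.equivFunOnFinite.symm c) := by
      simp [MvPolynomial.monomial_eq, Finsupp.prod_fintype]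
    rw [hmonomial, Module.Basis.constr_basis]
    rfl
  have hexpand : (∏ v, MvPolynomial.X v) * (∑ v, MvPolynomial.X v) ^ k
      = ∑ s ∈ univ.piAntidiag k, Nat.multinomial univ s •
          ∏ v, (MvPolynomial.X v : MvPolynomial V ℕ) ^ (s + 1) v := by
    rw [sum_pow_eq_sum_piAntidiag, mul_sum]
    refine sum_congr rfl fun s _ => ?_
    simp only [Pi.add_apply, Pi.one_apply, pow_succ, prod_mul_distrib, nsmul_eq_mul]
    ring
  have h := congrArg L (factorial_mul_sum_prod_pow_degree MvPolynomial.X r k)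
  simpa only [hexpand, ← nsmul_eq_mul, map_nsmul, map_sum, hL, smul_eq_mul] using h

theorem card_piAntidiag_univ (k : ℕ) :
    #((univ : Finset V).piAntidiag k) = (Fintype.card V).multichoose k := by
  rw [← map_sym_eq_piAntidiag, card_map, sym_univ, card_univ, Sym.card_sym_eq_multichoose]

end DegreeEnumerator

section Counting

open Nat (factorial)

theorem isCycleOn_univ_iff_cycleType_eq {α : Type*} [Fintype α] [DecidableEq α] [Nontrivial α]
    {σ : Equiv.Perm α} : σ.IsCycleOn Set.univ ↔ σ.cycleType = {Fintype.card α} := by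
  constructor
  · intro hσ
    have hsupport : σ.support = univ := by
      ext a
      simpa using hσ.apply_ne Set.nontrivial_univ (Set.mem_univ a)
    have hcycle : σ.IsCycle := Equiv.Perm.isCycle_iff_exists_isCycleOn.mpr
      ⟨Set.univ, Set.nontrivial_univ, hσ, fun _ _ => Set.mem_univ _⟩
    rw [hcycle.cycleType, hsupport, card_univ]
  · intro hσ
    have hcycle : σ.IsCycle := by
      rw [← Equiv.Perm.card_cycleType_eq_one, hσ, Multiset.card_singleton]
    have hsupport : σ.support = univ := by
      rw [← card_eq_iff_eq_univ, ← Equiv.Perm.sum_cycleType, hσ, Multiset.sum_singleton]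
    have hmoved : {a | σ a ≠ a} = Set.univ :=
      Set.eq_univ_of_forall fun a => Equiv.Perm.mem_support.mp (hsupport ▸ mem_univ a)
    exact hmoved ▸ hcycle.isCycleOn

theorem card_cyclicOrder (α : Type*) [Finite α] :
    Nat.card (CyclicOrder α) = factorial (Nat.card α - 1) := by
  classical
  have := Fintype.ofFinite α
  rcases subsingleton_or_nontrivial α with _ | _
  · rw [Nat.sub_eq_zero_of_le (Finite.card_le_one_iff_subsingleton.mpr ‹_›), Nat.factorial_zero,
      Nat.card_eq_one_iff_unique]
    exact ⟨inferInstance, ⟨1, Equiv.Perm.isCycleOn_of_subsingleton _ _⟩⟩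
  · have hcycleType := Equiv.Perm.card_of_cycleType_singleton (α := α) Fintype.one_lt_card le_rfl
    rw [Nat.choose_self, mul_one] at hcycleType
    simp only [CyclicOrder, isCycleOn_univ_iff_cycleType_eq]
    rw [Nat.card_eq_fintype_card, Nat.card_eq_fintype_card, ← hcycleType, Fintype.card_subtype]

variable {V B : Type*}

theorem Hypertree.card_edgesAt [DecidableEq V] (T : Hypertree V) (v : V) :
    Nat.card (T.EdgesAt v) = T.degree v := by
  rw [degree, Nat.subtype_card]
  simp

/-- The rooted partition whose blocks are the fibres of `g`. -/
def rootedFibers [DecidableEq V] (r : V) (g : {v // v ≠ r} → B) (v : V) : Option B :=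
  if hv : v = r then none else some (g ⟨v, hv⟩)

theorem rootedFibers_eq_some_iff [DecidableEq V] {r : V} {g : {v // v ≠ r} → B} {v : V} {b : B} :
    rootedFibers r g v = some b ↔ ∃ hv : v ≠ r, g ⟨v, hv⟩ = b := by
  by_cases hv : v = r <;> simp [rootedFibers, hv]

theorem isRootedPartition_rootedFibers [DecidableEq V] {r : V} {g : {v // v ≠ r} → B}
    (hg : Function.Surjective g) : IsRootedPartition r (rootedFibers r g) where
  eq_none_iff v := by simp [rootedFibers]
  exists_eq_some b := by
    obtain ⟨⟨v, hv⟩, rfl⟩ := hg b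
    exact ⟨v, rootedFibers_eq_some_iff.mpr ⟨hv, rfl⟩⟩

theorem card_isRootedPartition (r : V) :
    Nat.card {β : V → Option B // IsRootedPartition r β}
      = Nat.card {g : {v // v ≠ r} → B // Function.Surjective g} := by
  classical
  refine (Nat.card_eq_of_bijective
    (fun g => ⟨rootedFibers r g.1, isRootedPartition_rootedFibers g.2⟩) ⟨?_, ?_⟩).symm
  · intro g g' hgg'
    ext ⟨v, hv⟩
    have := congrFun (congrArg Subtype.val hgg') v
    simpa [rootedFibers, hv] using this
  · rintro ⟨β, hβ⟩
    choose g hg using fun v : {v // v ≠ r} =>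
      Option.ne_none_iff_exists'.mp fun hv => v.2 ((hβ.eq_none_iff v).mp hv)
    refine ⟨⟨g, fun b => ?_⟩, Subtype.ext (funext fun v => ?_)⟩
    · obtain ⟨v, hv⟩ := hβ.exists_eq_some b
      have hvr : v ≠ r := fun hvr => by simp [(hβ.eq_none_iff v).mpr hvr] at hv
      exact ⟨⟨v, hvr⟩, Option.some.inj ((hg ⟨v, hvr⟩).symm.trans hv)⟩
    · by_cases hv : v = r
      · simp [rootedFibers, hv, (hβ.eq_none_iff r).mpr rfl]
      · simp [rootedFibers, hv, hg ⟨v, hv⟩]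

variable [Fintype V]

theorem card_surjective_eq_sum [Fintype B] :
    (Nat.card {g : V → B // Function.Surjective g} : ℤ)
      = ∑ j ∈ range (Fintype.card B + 1), (-1) ^ j * (Fintype.card B).choose j
          * ((Fintype.card B - j : ℕ) : ℤ) ^ Fintype.card V := by
  classical
  let missing (b : B) : Finset (V → B) := univ.filter fun g => ∀ v, g v ≠ b
  have hmissing (s : Finset B) :
      #(s.inf missing) = (Fintype.card B - #s) ^ Fintype.card V := by
    have : s.inf missing = Fintype.piFinset fun _ => sᶜ := by
      ext g
      simp only [missing, mem_inf, mem_filter, mem_univ, true_and, Fintype.mem_piFinset,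
        mem_compl]
      exact ⟨fun h v hv => h _ hv v rfl, fun h b hb v hv => h v (hv ▸ hb)⟩
    simp [this, card_compl]
  have hsurj : Nat.card {g : V → B // Function.Surjective g}
      = #((univ : Finset B).inf fun b => (missing b)ᶜ) := by
    rw [Nat.card_eq_fintype_card, Fintype.card_subtype]
    congr 1
    ext g
    simp only [missing, mem_inf, mem_compl, mem_filter_univ, not_forall, not_not, mem_univ,
      true_implies]
    rfl
  rw [hsurj, inclusion_exclusion_card_inf_compl]
  simp only [hmissing, Nat.cast_pow]
  rw [sum_powerset_apply_card fun j =>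
    (-1 : ℤ) ^ j * ((Fintype.card B - j : ℕ) : ℤ) ^ Fintype.card V, card_univ]
  exact sum_congr rfl fun j _ => by rw [nsmul_eq_mul]; ring

theorem coeff_exp_sub_one_pow (K : Type*) [Field K] [CharZero K] (m k : ℕ) :
    (m.factorial : K) * PowerSeries.coeff m ((PowerSeries.exp K - 1) ^ k)
      = ∑ j ∈ range (k + 1), (-1) ^ j * k.choose j * ((k - j : ℕ) : K) ^ m := by
  have hm : (m.factorial : K) ≠ 0 := Nat.cast_ne_zero.mpr m.factorial_ne_zero
  rw [← neg_add_eq_sub, add_pow, map_sum, mul_sum]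
  refine sum_congr rfl fun j _ => ?_
  rw [PowerSeries.exp_pow_eq_rescale_exp, mul_right_comm, ← map_natCast (PowerSeries.C (R := K)),
    ← map_one (PowerSeries.C (R := K)), ← map_neg, ← map_pow, ← map_mul, PowerSeries.coeff_C_mul,
    PowerSeries.coeff_rescale, PowerSeries.coeff_exp]
  simp only [one_div, map_inv₀, map_natCast]
  field_simp

theorem card_surjective (K : Type*) [Field K] [CharZero K] [Fintype B] :
    (Nat.card {g : V → B // Function.Surjective g} : K)
      = (Fintype.card V).factorial
          * PowerSeries.coeff (Fintype.card V) ((PowerSeries.exp K - 1) ^ Fintype.card B) := by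
  rw [coeff_exp_sub_one_pow]
  exact_mod_cast congrArg (Int.cast : ℤ → K) card_surjective_eq_sum

end Counting

section CyclicCounting

open Nat (factorial)

theorem succ_mul_multichoose (n k : ℕ) :
    (k + 1) * n.multichoose (k + 1) = (n + k) * n.multichoose k := by
  rcases n.eq_zero_or_pos with rfl | hn
  · cases k <;> simp
  · obtain ⟨n, rfl⟩ := Nat.exists_eq_add_of_lt hn
    have h := Nat.add_one_mul_choose_eq (n + k) k
    simp only [Nat.multichoose_eq]
    rw [show 0 + n + 1 + (k + 1) - 1 = n + k + 1 by omega,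
      show 0 + n + 1 + k - 1 = n + k by omega, mul_comm (k + 1), ← h]
    ring

theorem mul_multichoose_succ (n k : ℕ) :
    n * (n + 1).multichoose k = (k + 1) * n.multichoose (k + 1) := by
  rw [succ_mul_multichoose]
  rcases n with _ | n
  · cases k <;> simp
  · have h := Nat.choose_mul_succ_eq (n + k) k
    rw [show n + k + 1 - k = n + 1 by omega] at h
    simp only [Nat.multichoose_eq]
    rw [show n + 1 + 1 + k - 1 = n + k + 1 by omega, show n + 1 + k - 1 = n + k by omega]
    linear_combination h.symm

variable {V : Type*} [Fintype V] [DecidableEq V]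

theorem sum_piAntidiag_multinomial_mul_prod_factorial (k : ℕ) :
    ∑ s ∈ (univ : Finset V).piAntidiag k, Nat.multinomial univ s * ∏ v, factorial (s v)
      = factorial k * (Fintype.card V).multichoose k := by
  rw [← card_piAntidiag_univ, mul_comm, ← smul_eq_mul, ← sum_const]
  refine sum_congr rfl fun s hs => ?_
  rw [mul_comm, Nat.multinomial_spec, (mem_piAntidiag.mp hs).1]

theorem factorial_mul_sum_cyclicOrders (r : V) (k : ℕ) :
    factorial (k + 1) * ∑ T : Hypertree V with #T.edges = k + 1, ∏ v, factorial (T.degree v - 1)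
      = Nat.card {g : {v // v ≠ r} → Fin (k + 1) // Function.Surjective g}
          * (factorial k * (Fintype.card V).multichoose k) := by
  rw [factorial_mul_sum_degree (fun c => ∏ v, factorial (c v - 1)) r, card_isRootedPartition]
  simp [sum_piAntidiag_multinomial_mul_prod_factorial]

theorem factorial_mul_sum_flags (r : V) (k : ℕ) :
    factorial (k + 1) * ∑ T : Hypertree V with #T.edges = k + 1,
        (∏ v, factorial (T.degree v - 1)) * ∑ v, T.degree v
      = Nat.card {g : {v // v ≠ r} → Fin (k + 1) // Function.Surjective g}
          * (factorial (k + 1) * (Fintype.card V).multichoose (k + 1)) := by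
  have hsum (s : V → ℕ) (hs : s ∈ univ.piAntidiag k) :
      ∑ v, (s + 1) v = Fintype.card V + k := by
    simp [sum_add_distrib, (mem_piAntidiag.mp hs).1, add_comm]
  rw [factorial_mul_sum_degree (fun c => (∏ v, factorial (c v - 1)) * ∑ v, c v) r,
    card_isRootedPartition]
  congr 1
  rw [sum_congr rfl fun s hs => by rw [hsum s hs, ← mul_assoc], ← sum_mul]
  simp only [Pi.add_apply, Pi.one_apply, Nat.add_sub_cancel]
  rw [sum_piAntidiag_multinomial_mul_prod_factorial, Nat.factorial_succ]
  linear_combination factorial k * (succ_mul_multichoose (Fintype.card V) k).symm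

theorem Hypertree.card_cyclicOrders (T : Hypertree V) :
    Nat.card ((v : V) → CyclicOrder (T.EdgesAt v)) = ∏ v, factorial (T.degree v - 1) := by
  simp only [Nat.card_pi, card_cyclicOrder, T.card_edgesAt]

theorem Hypertree.card_flags (T : Hypertree V) :
    Nat.card ((v : V) × T.EdgesAt v) = ∑ v, T.degree v := by
  simp only [Nat.card_sigma, T.card_edgesAt]

theorem sum_sigma_fst {α R : Type*} {β : α → Type*} [Semiring R] [Fintype α] [∀ a, Finite (β a)]
    [Fintype (Σ a, β a)] (F : α → R) :
    ∑ p : (Σ a, β a), F p.1 = ∑ a, (Nat.card (β a) : R) * F a := by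
  have (a : α) : Fintype (β a) := Fintype.ofFinite _
  convert Fintype.sum_sigma fun p : Σ a, β a => F p.1 with a
  simp

variable {R : Type*} [CommSemiring R]

theorem sum_cyclicHypertree (F : Hypertree V → R) :
    ∑ H : CyclicHypertree V, F H.1
      = ∑ T : Hypertree V, ((∏ v, factorial (T.degree v - 1) : ℕ) : R) * F T := by
  rw [sum_sigma_fst]
  simp only [Hypertree.card_cyclicOrders]

theorem sum_flagPointedCyclicHypertree (F : Hypertree V → R) :
    ∑ H : FlagPointedCyclicHypertree V, F H.1.1
      = ∑ T : Hypertree V,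
          (((∏ v, factorial (T.degree v - 1)) * ∑ v, T.degree v : ℕ) : R) * F T := by
  rw [sum_sigma_fst fun H : CyclicHypertree V => F H.1]
  simp only [Hypertree.card_flags]
  rw [sum_cyclicHypertree fun T => ((∑ v, T.degree v : ℕ) : R) * F T]
  simp only [Nat.cast_mul, mul_assoc]

omit [DecidableEq V] in
theorem sum_mul_pow_rank (F : Hypertree V → R) (t : R) {m : ℕ} (hV : Fintype.card V = m + 1) :
    ∑ T, F T * t ^ T.rank
      = ∑ k ∈ range m, t ^ k * ∑ T : Hypertree V with #T.edges = k + 1, F T := by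
  have hcard (T : Hypertree V) : #T.edges = T.rank + 1 :=
    (Nat.sub_add_cancel (card_pos.mpr T.isHypergraph.1)).symm
  have hrank (T : Hypertree V) : T.rank ∈ range m := by
    have := T.card_edges_lt
    rw [hcard, hV] at this
    exact mem_range.mpr (Nat.lt_of_succ_lt_succ this)
  rw [← sum_fiberwise_of_maps_to fun T _ => hrank T]
  refine sum_congr rfl fun k _ => ?_
  simp only [hcard, Nat.add_right_cancel_iff, mul_sum]
  refine sum_congr rfl fun T hT => ?_
  rw [(mem_filter.mp hT).2, mul_comm]

end CyclicCounting

section LagrangeInversion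

open PowerSeries

section CommRing

variable {R : Type*} [CommRing R]

theorem subst_one_of_hasSubst {a : R⟦X⟧} (ha : HasSubst a) : (1 : R⟦X⟧).subst a = 1 := by
  simpa using subst_coe (R := R) (S := R) ha (1 : Polynomial R)

theorem coeff_pow_eq_zero_of_lt {a : R⟦X⟧} (ha : constantCoeff a = 0) {n j : ℕ} (h : n < j) :
    coeff n (a ^ j) = 0 :=
  X_pow_dvd_iff.mp (pow_dvd_pow_of_dvd (X_dvd_iff.mpr ha) j) n h

theorem coeff_subst_eq_sum_range {a : R⟦X⟧} (ha : constantCoeff a = 0) (f : R⟦X⟧) {n N : ℕ}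
    (h : n < N) : coeff n (f.subst a) = ∑ j ∈ range N, coeff j f * coeff n (a ^ j) := by
  rw [coeff_subst' (HasSubst.of_constantCoeff_zero' ha)]
  refine finsum_eq_sum_of_support_subset _ fun j hj => ?_
  by_contra hjN
  have hNj : N ≤ j := by simpa using hjN
  exact hj (by simp [coeff_pow_eq_zero_of_lt ha (h.trans_le hNj)])

theorem coeff_subst_mul {a : R⟦X⟧} (ha : constantCoeff a = 0) (f g : R⟦X⟧) (n : ℕ) :
    coeff n (f.subst a * g) = ∑ j ∈ range (n + 1), coeff j f * coeff n (a ^ j * g) := by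
  simp only [coeff_mul, mul_sum]
  rw [sum_comm]
  refine sum_congr rfl fun p hp => ?_
  rw [coeff_subst_eq_sum_range ha f (Nat.antidiagonal.fst_lt hp), sum_mul]
  exact sum_congr rfl fun j _ => mul_assoc _ _ _

theorem coeff_pow_succ_of_mul_one_sub_eq_one {φ u : R⟦X⟧} (hu : constantCoeff u = 0)
    (h : φ * (1 - u) = 1) (d n : ℕ) :
    coeff n (φ ^ (d + 1))
      = ∑ j ∈ range (n + 1), ((d + 1).multichoose j : R) * coeff n (u ^ j) := by
  have hu' := HasSubst.of_constantCoeff_zero' hu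
  have hinv := congrArg (subst u) (mk_add_choose_mul_one_sub_pow_eq_one R d)
  rw [subst_mul hu', subst_pow hu', subst_sub hu', subst_one_of_hasSubst hu', subst_X hu'] at hinv
  have hφ : φ ^ (d + 1) = subst u (mk fun j => ((d + j).choose d : R)) := by
    refine (left_inv_eq_right_inv hinv ?_).symm
    rw [← mul_pow, mul_comm, h, one_pow]
  rw [hφ, coeff_subst_eq_sum_range hu _ n.lt_succ_self]
  refine sum_congr rfl fun j _ => ?_
  rw [coeff_mk, Nat.multichoose_eq, Nat.add_right_comm, Nat.add_sub_cancel, Nat.choose_symm_add]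

theorem derivative_eq_neg_of_mul_eq_one {φ ψ : R⟦X⟧} (h : φ * ψ = 1) :
    derivative R φ = -(φ ^ 2 * derivative R ψ) := by
  have hleibniz := congrArg (derivative R) h
  simp only [Derivation.leibniz, smul_eq_mul, derivative_one] at hleibniz
  linear_combination φ * hleibniz - derivative R φ * h

theorem succ_nsmul_derivative_X_mul_mul_pow {φ ψ : R⟦X⟧} (h : φ * ψ = 1) (m : ℕ) :
    (m + 1) • (derivative R (X * ψ) * φ ^ (m + 2))
      = (m + 1) • φ ^ (m + 1) - X * derivative R (φ ^ (m + 1)) := by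
  rw [Derivation.leibniz, Derivation.leibniz_pow, derivative_eq_neg_of_mul_eq_one h]
  simp only [derivative_X, smul_eq_mul, nsmul_eq_mul, Nat.add_sub_cancel]
  linear_combination ((m + 1 : ℕ) : R⟦X⟧) * φ ^ (m + 1) * h

theorem coeff_derivative_X_mul_mul_pow [IsAddTorsionFree R] {φ ψ : R⟦X⟧} (h : φ * ψ = 1) (m : ℕ) :
    coeff m (derivative R (X * ψ) * φ ^ (m + 1)) = if m = 0 then 1 else 0 := by
  cases m with
  | zero => simpa [Derivation.leibniz, mul_comm] using congrArg constantCoeff h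
  | succ m =>
    refine (smul_eq_zero_iff_right m.succ_ne_zero).mp ?_
    rw [← map_nsmul, succ_nsmul_derivative_X_mul_mul_pow h, map_sub, map_nsmul, coeff_succ_X_mul,
      coeff_derivative, nsmul_eq_mul, Nat.cast_succ, mul_comm, sub_self]

theorem succ_mul_coeff_succ_eq_coeff_derivative_subst_mul_pow [IsAddTorsionFree R] {φ ψ : R⟦X⟧}
    (h : φ * ψ = 1) (f : R⟦X⟧) (n : ℕ) :
    (n + 1) * coeff (n + 1) f = coeff n (derivative R (f.subst (X * ψ)) * φ ^ (n + 1)) := by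
  have hg : constantCoeff (X * ψ) = 0 := by simp
  have hresidue (j : ℕ) (hj : j ∈ range (n + 1)) :
      coeff n ((X * ψ) ^ j * (derivative R (X * ψ) * φ ^ (n + 1))) = if j = n then 1 else 0 := by
    obtain ⟨m, rfl⟩ := Nat.exists_eq_add_of_le (mem_range_succ_iff.mp hj)
    have hcancel : (X * ψ) ^ j * (derivative R (X * ψ) * φ ^ (j + m + 1))
        = X ^ j * (derivative R (X * ψ) * φ ^ (m + 1)) := by
      have hj : (φ * ψ) ^ j = 1 := by rw [h, one_pow]
      rw [mul_pow] at hj ⊢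
      linear_combination X ^ j * (derivative R (X * ψ) * φ ^ (m + 1)) * hj
    rw [hcancel, add_comm j m, coeff_X_pow_mul, coeff_derivative_X_mul_mul_pow h]
    simp
  rw [derivative_subst (HasSubst.of_constantCoeff_zero' hg), mul_assoc, coeff_subst_mul hg,
    sum_congr rfl fun j hj => by rw [hresidue j hj]]
  simp [coeff_derivative, mul_comm]

theorem subst_eq_X_comm {f g : R⟦X⟧} (hf : constantCoeff f = 0) (hg : constantCoeff g = 0)
    (hunit : IsUnit (coeff 1 f)) (h : f.subst g = X) : g.subst f = X := by
  have hf' := HasSubst.of_constantCoeff_zero' hf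
  have hg' := HasSubst.of_constantCoeff_zero' hg
  have hleft := subst_substInvOfIsUnit_left f hf hunit
  have heq := congrArg (subst g) hleft
  rw [subst_comp_subst_apply hf' hg', h, X_subst, subst_X hg'] at heq
  rwa [← heq]

theorem lagrange_inversion [IsAddTorsionFree R] {φ ψ z : R⟦X⟧} (h : φ * ψ = 1)
    (hz : constantCoeff z = 0) (hinv : (X * ψ).subst z = X) (f : R⟦X⟧) (n : ℕ) :
    (n + 1) * coeff (n + 1) (f.subst z) = coeff n (derivative R f * φ ^ (n + 1)) := by
  have hg : constantCoeff (X * ψ) = 0 := by simp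
  have hunit : IsUnit (coeff 1 (X * ψ)) := by
    rw [← zero_add 1, coeff_succ_X_mul]
    refine IsUnit.of_mul_eq_one (coeff 0 φ) ?_
    simpa [mul_comm] using congrArg constantCoeff h
  have hz' := HasSubst.of_constantCoeff_zero' hz
  have hg' := HasSubst.of_constantCoeff_zero' hg
  rw [succ_mul_coeff_succ_eq_coeff_derivative_subst_mul_pow h, subst_comp_subst_apply hz' hg',
    subst_eq_X_comm hg hz hunit hinv, X_subst]

end CommRing

section Logarithm

variable {R : Type*} [CommRing R] [Algebra ℚ R]

theorem subst_logOf {f a : R⟦X⟧} (hf : constantCoeff f = 1) (ha : constantCoeff a = 0) :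
    (logOf f).subst a = logOf (f.subst a) := by
  have ha' := HasSubst.of_constantCoeff_zero' ha
  have hf' : HasSubst (f - 1) := HasSubst.of_constantCoeff_zero' (by simp [hf])
  rw [logOf_eq, logOf_eq, subst_comp_subst_apply hf' ha', subst_sub ha',
    subst_one_of_hasSubst ha']

theorem derivative_log_mul_one_add_X : derivative R (log R) * (1 + X) = 1 := by
  rw [deriv_log]
  ext n
  cases n with
  | zero => simp [mul_add]
  | succ n => simp [mul_add, coeff_succ_mul_X, coeff_one, pow_succ]

theorem derivative_logOf_mul {f : R⟦X⟧} (hf : constantCoeff f = 1) :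
    derivative R (logOf f) * f = derivative R f := by
  have hf' : HasSubst (f - 1) := HasSubst.of_constantCoeff_zero' (by simp [hf])
  have hsubst := congrArg (subst (f - 1)) (derivative_log_mul_one_add_X (R := R))
  rw [subst_mul hf', subst_add hf', subst_one_of_hasSubst hf', subst_X hf'] at hsubst
  rw [logOf_eq, derivative_subst hf', map_sub, derivative_one]
  linear_combination derivative R f * hsubst

theorem succ_nsmul_derivative_logOf_mul_pow {φ ψ : R⟦X⟧} (h : φ * ψ = 1)
    (hψ : constantCoeff ψ = 1) (n : ℕ) :
    (n + 1) • (derivative R (logOf ψ) * φ ^ (n + 1)) = -derivative R (φ ^ (n + 1)) := by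
  rw [Derivation.leibniz_pow, derivative_eq_neg_of_mul_eq_one h, ← derivative_logOf_mul hψ]
  simp only [smul_eq_mul, nsmul_eq_mul, Nat.add_sub_cancel]
  linear_combination -((n + 1 : ℕ) : R⟦X⟧) * derivative R (logOf ψ) * φ ^ (n + 1) * h

theorem succ_mul_coeff_succ_logOf_subst {φ ψ z : R⟦X⟧} (h : φ * ψ = 1)
    (hψ : constantCoeff ψ = 1) (hz : constantCoeff z = 0) (hinv : (X * ψ).subst z = X) (n : ℕ) :
    (n + 1) * coeff (n + 1) (logOf (ψ.subst z)) = -coeff (n + 1) (φ ^ (n + 1)) := by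
  have : IsAddTorsionFree R := .of_module_rat R
  have hcoeff := congrArg (coeff n) (succ_nsmul_derivative_logOf_mul_pow h hψ n)
  rw [map_nsmul, ← lagrange_inversion h hz hinv, subst_logOf hψ hz, map_neg, coeff_derivative]
    at hcoeff
  refine nsmul_right_injective n.succ_ne_zero (hcoeff.trans ?_)
  simp only [Nat.succ_eq_add_one, nsmul_eq_mul, Nat.cast_succ]
  ring

end Logarithm

end LagrangeInversion

section Coefficients

open PowerSeries
open Nat (factorial)

variable {K : Type*} [Field K] [CharZero K]

theorem card_surjective_ne {V : Type*} [Fintype V] (r : V) {m : ℕ}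
    (hV : Fintype.card V = m + 1) (k : ℕ) :
    (Nat.card {g : {v // v ≠ r} → Fin k // Function.Surjective g} : K)
      = factorial m * coeff m ((exp K - 1) ^ k) := by
  classical
  have hcard : Fintype.card {v // v ≠ r} = m := by
    rw [Fintype.card_subtype_compl, hV, Fintype.card_subtype_eq, Nat.add_sub_cancel]
  rw [card_surjective, hcard, Fintype.card_fin]

theorem sum_flags {V : Type*} [Fintype V] [DecidableEq V] {m : ℕ}
    (hV : Fintype.card V = m + 1) (k : ℕ) :
    ∑ T : Hypertree V with #T.edges = k + 1,
        (((∏ v, factorial (T.degree v - 1)) * ∑ v, T.degree v : ℕ) : K)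
      = factorial m * ((m + 1).multichoose (k + 1) * coeff m ((exp K - 1) ^ (k + 1))) := by
  obtain ⟨r⟩ : Nonempty V := Fintype.card_pos_iff.mp (hV ▸ m.succ_pos)
  have h := congrArg (Nat.cast : ℕ → K) (factorial_mul_sum_flags r k)
  rw [Nat.cast_mul, Nat.cast_mul, Nat.cast_mul, Nat.cast_sum,
    card_surjective_ne r hV, hV] at h
  refine mul_left_cancel₀ (Nat.cast_ne_zero.mpr (k + 1).factorial_ne_zero) (h.trans ?_)
  ring

theorem mul_sum_cyclicOrders {V : Type*} [Fintype V] [DecidableEq V] {m : ℕ}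
    (hV : Fintype.card V = m + 1) (k : ℕ) :
    m * ∑ T : Hypertree V with #T.edges = k + 1,
        ((∏ v, factorial (T.degree v - 1) : ℕ) : K)
      = factorial m * (m.multichoose (k + 1) * coeff m ((exp K - 1) ^ (k + 1))) := by
  obtain ⟨r⟩ : Nonempty V := Fintype.card_pos_iff.mp (hV ▸ m.succ_pos)
  have h := congrArg (Nat.cast : ℕ → K) (factorial_mul_sum_cyclicOrders r k)
  rw [Nat.cast_mul, Nat.cast_mul, Nat.cast_mul, Nat.cast_sum,
    card_surjective_ne r hV, hV] at h
  have hchoose := congrArg (Nat.cast : ℕ → K) (mul_multichoose_succ m k)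
  have hfactorial := congrArg (Nat.cast : ℕ → K) (Nat.factorial_succ k)
  push_cast at h hchoose hfactorial ⊢
  refine mul_left_cancel₀ (Nat.cast_ne_zero.mpr (k + 1).factorial_ne_zero) ?_
  rw [hfactorial] at h ⊢
  linear_combination m * h
    + factorial m * coeff m ((exp K - 1) ^ (k + 1)) * factorial k * hchoose

theorem factorial_succ_mul_div (m : ℕ) (S : K) :
    (m + 1) * (factorial m * S / factorial (m + 1)) = S := by
  have h := Nat.cast_ne_zero (R := K).mpr m.factorial_ne_zero
  have := Nat.cast_add_one_ne_zero (R := K) m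
  rw [Nat.factorial_succ, Nat.cast_mul, Nat.cast_succ]
  field_simp

theorem mul_coeff_succ_HACpa (t : K) (m : ℕ) :
    t * ((m + 1) * coeff (m + 1) (HACpa t))
      = ∑ k ∈ range m, ((m + 1).multichoose (k + 1) : K)
          * coeff m ((t • (exp K - 1)) ^ (k + 1)) := by
  rw [HACpa, coeff_mk, sum_flagPointedCyclicHypertree (t ^ Hypertree.rank ·),
    sum_mul_pow_rank _ t (Fintype.card_fin _)]
  simp only [sum_flags (Fintype.card_fin _), mul_left_comm (t ^ _) (factorial m : K)]
  rw [← mul_sum, factorial_succ_mul_div, mul_sum]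
  refine sum_congr rfl fun k _ => ?_
  rw [smul_pow, coeff_smul, smul_eq_mul]
  ring

theorem mul_coeff_succ_HAC (t : K) (m : ℕ) :
    t * (m * ((m + 1) * coeff (m + 1) (HAC t)))
      = ∑ k ∈ range m, (m.multichoose (k + 1) : K) * coeff m ((t • (exp K - 1)) ^ (k + 1)) := by
  rw [HAC, coeff_mk, sum_cyclicHypertree (t ^ Hypertree.rank ·),
    sum_mul_pow_rank _ t (Fintype.card_fin _), mul_left_comm (m : K), ← mul_div_assoc, mul_sum]
  simp only [mul_left_comm (m : K), mul_sum_cyclicOrders (Fintype.card_fin _),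
    mul_left_comm (t ^ _) (factorial m : K)]
  rw [← mul_sum, factorial_succ_mul_div, mul_sum]
  refine sum_congr rfl fun k _ => ?_
  rw [smul_pow, coeff_smul, smul_eq_mul]
  ring

omit [CharZero K] in
theorem constantCoeff_HACpa (t : K) : constantCoeff (HACpa t) = 0 := by
  have : IsEmpty (FlagPointedCyclicHypertree (Fin 0)) := ⟨fun F => F.2.1.elim0⟩
  rw [← coeff_zero_eq_constantCoeff_apply, HACpa, coeff_mk, Fintype.sum_empty, zero_div]

omit [CharZero K] in
theorem coeff_one_HAC (t : K) : coeff 1 (HAC t) = 0 := by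
  rw [HAC, coeff_mk, sum_cyclicHypertree (t ^ Hypertree.rank ·),
    sum_mul_pow_rank _ t (Fintype.card_fin _), sum_range_zero, zero_div]

end Coefficients

section System

open PowerSeries

variable {K : Type*} [Field K] [CharZero K] {t : K} {z : K⟦X⟧}

/-- The series `1 - t (exp X - 1)`: the second equation of the system says that substituting `z`
into it gives the quotient `B / z`. -/
noncomputable def quotientSeries (t : K) : K⟦X⟧ := 1 - t • (exp K - 1)

theorem constantCoeff_quotientSeries (t : K) : constantCoeff (quotientSeries t) = 1 := by
  simp [quotientSeries]

theorem inv_quotientSeries_mul (t : K) : (quotientSeries t)⁻¹ * quotientSeries t = 1 :=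
  PowerSeries.inv_mul_cancel _ (by simp [constantCoeff_quotientSeries])

theorem coeff_inv_quotientSeries_pow (t : K) (d n : ℕ) :
    coeff n ((quotientSeries t)⁻¹ ^ (d + 1))
      = ∑ k ∈ range n, ((d + 1).multichoose (k + 1) : K) * coeff n ((t • (exp K - 1)) ^ (k + 1))
        + coeff n 1 := by
  rw [coeff_pow_succ_of_mul_one_sub_eq_one (by simp) (inv_quotientSeries_mul t), sum_range_succ']
  simp

theorem subst_quotientSeries (hz : constantCoeff z = 0) :
    (quotientSeries t).subst z = 1 - t • ((exp K).subst z - 1) := by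
  have hz' := HasSubst.of_constantCoeff_zero' hz
  rw [quotientSeries, subst_sub hz', subst_smul hz', subst_sub hz', subst_one_of_hasSubst hz']

theorem subst_X_mul_quotientSeries (hz : constantCoeff z = 0) :
    (X * quotientSeries t).subst z = z * (quotientSeries t).subst z := by
  have hz' := HasSubst.of_constantCoeff_zero' hz
  rw [subst_mul hz', subst_X hz']

theorem constantCoeff_subst_quotientSeries (hz : constantCoeff z = 0) :
    constantCoeff ((quotientSeries t).subst z) = 1 := by
  rw [← coeff_zero_eq_constantCoeff_apply, coeff_subst_eq_sum_range hz _ zero_lt_one,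
    sum_range_one, pow_zero, coeff_zero_one, mul_one, coeff_zero_eq_constantCoeff_apply,
    constantCoeff_quotientSeries]

theorem isSolution_iff {A : K⟦X⟧} :
    IsSolution t A z ↔ constantCoeff z = 0 ∧ (X * quotientSeries t).subst z = X ∧
      A = -(1 / t) • logOf ((quotientSeries t).subst z) := by
  refine and_congr_right fun hz => ?_
  have hsystem : X = z - t • (z * ((exp K).subst z - 1))
      ↔ z * (quotientSeries t).subst z = X := by
    rw [subst_quotientSeries hz, mul_sub z 1, mul_one, mul_smul_comm, eq_comm]
  rw [hsystem, subst_X_mul_quotientSeries hz]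
  constructor
  · rintro ⟨⟨q, hq, -, rfl⟩, hX⟩
    have hz0 : z ≠ 0 := by
      rintro rfl
      exact X_ne_zero (hq.symm.trans (mul_zero q))
    rw [← hX, mul_comm] at hq
    exact ⟨hX, by rw [mul_left_cancel₀ hz0 hq]⟩
  · rintro ⟨hX, hA⟩
    exact ⟨⟨_, (mul_comm _ _).trans hX, constantCoeff_subst_quotientSeries hz, hA⟩, hX⟩

theorem exists_subst_eq_X (t : K) :
    ∃ z : K⟦X⟧, constantCoeff z = 0 ∧ (X * quotientSeries t).subst z = X := by
  have hunit : IsUnit (coeff 1 (X * quotientSeries t)) := by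
    rw [← zero_add 1, coeff_succ_X_mul]
    simp [constantCoeff_quotientSeries]
  exact ⟨_, constantCoeff_substInvOfIsUnit _ hunit,
    subst_substInvOfIsUnit_right _ (by simp) hunit⟩

theorem eq_X_add_smul_HACpa (hz : constantCoeff z = 0)
    (hinv : (X * quotientSeries t).subst z = X) : z = X + t • HACpa t := by
  ext n
  cases n with
  | zero => simp [hz, constantCoeff_HACpa]
  | succ m =>
    have hlagrange := lagrange_inversion (inv_quotientSeries_mul t) hz hinv X m
    rw [subst_X (HasSubst.of_constantCoeff_zero' hz), derivative_X, one_mul,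
      coeff_inv_quotientSeries_pow, ← mul_coeff_succ_HACpa] at hlagrange
    have hX : (m + 1) * coeff (m + 1) (X : K⟦X⟧) = coeff m 1 := by
      cases m <;> simp [coeff_X, coeff_one]
    refine mul_left_cancel₀ (Nat.cast_add_one_ne_zero m) ?_
    rw [map_add, coeff_smul, smul_eq_mul]
    linear_combination hlagrange - hX

theorem logOf_eq_derivative_HAC (ht : t ≠ 0) (hz : constantCoeff z = 0)
    (hinv : (X * quotientSeries t).subst z = X) :
    -(1 / t) • logOf ((quotientSeries t).subst z) = derivative K (HAC t) := by
  ext n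
  rw [coeff_derivative, coeff_smul, smul_eq_mul]
  cases n with
  | zero =>
    simp [coeff_one_HAC, constantCoeff_logOf (constantCoeff_subst_quotientSeries hz)]
  | succ n =>
    have hlog := succ_mul_coeff_succ_logOf_subst (inv_quotientSeries_mul t)
      (constantCoeff_quotientSeries t) hz hinv n
    have hHAC := mul_coeff_succ_HAC t (n + 1)
    rw [coeff_inv_quotientSeries_pow, ← hHAC, coeff_one, if_neg n.succ_ne_zero] at hlog
    push_cast at hlog ⊢
    refine mul_left_cancel₀ (Nat.cast_add_one_ne_zero n) ?_
    linear_combination -(1 / t) * hlog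
      + (n + 1) * ((n + 1 + 1) * coeff (n + 2) (HAC t)) * one_div_mul_cancel ht

end System

end HypertreeSeries

open HypertreeSeries in
theorem mainTheorem3 {K : Type*} [Field K] [CharZero K] (t : K) (ht : t ≠ 0) (A z : PowerSeries K) :
    HypertreeSeries.IsSolution t A z ↔
      (A = PowerSeries.derivative K (HypertreeSeries.HAC t) ∧
        z = PowerSeries.X + t • HypertreeSeries.HACpa t) := by
  rw [isSolution_iff]
  constructor
  · rintro ⟨hz, hinv, rfl⟩
    exact ⟨logOf_eq_derivative_HAC ht hz hinv, eq_X_add_smul_HACpa hz hinv⟩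
  · rintro ⟨rfl, rfl⟩
    obtain ⟨w, hw, hinv⟩ := exists_subst_eq_X t
    rw [← eq_X_add_smul_HACpa hw hinv]
    exact ⟨hw, hinv, (logOf_eq_derivative_HAC ht hw hinv).symm⟩
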